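/- Let $\mu$ be the standard normal distribution on $\mathbb{R}$ and $\mathcal{H}_n(x)=\frac{(-1)^n}{\sqrt{n!}}e^{x^2/2}D^n(e^{-x^2/2})$ the normalized Hermite polynomials, an orthonormal basis of $L^2(\mu)$. For probability distributions $\theta,\mu$ put $\chi_2(\theta,\mu)=\big(\int(\frac{d\theta}{d\mu}-1)^2d\mu\big)^{1/2}$ if $\theta\ll\mu$ and $+\infty$ otherwise, and $\chi_2(f)=\chi_2(f\cdot\mu,\mu)$. For densities $f,\phi$ with respect to $\mu$ and $a,b\in\mathbb{R}$, let $af*b\phi$ be the density with respect to $\mu$ of $aU+bV$, where $U\sim f\cdot\mu$ and $V\sim\phi\cdot\mu$ are independent. Let $r\ge 0$ be an integer and let $f,\phi\in L^2(\mu)$ be two probability densities with respect to $\mu$ whose moments of orders $1,\dots,r$ equal those of $\mu$. Assume that $\phi$ is a polynomial, let $N$ be an integer with $\deg\phi\le N$, and let $\phi_k=\int\phi\,\mathcal{H}_k\,d\mu$. Then $$\phi=1+\sum_{k=r+1}^N\phi_k\mathcal{H}_k .$$ Set $$a_\phi=\Big(1+\frac{N}{r+1}\Big)^{-1/4},\qquad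 d_\phi(a)=\sum_{k=r+1}^N\frac{|\phi_k|}{\sqrt{k!}}\Big(-2(r+1+N)\Big(1+\frac{N}{r+1}\Big)\log a\Big)^{k/2}\quad(0<a<1).$$ Put $K=r+1$ and $\gamma_k=\big(1+\frac NK\big)^{k/2}\frac{|\phi_k|}{\sqrt{k!}}$. For $r\ge1$, Hypothesis (H) consists of the following conditions (with $0^0=1$). (H1) $(k+2)\gamma_{k+2}\le\gamma_k$ for all $K\le k\le N-2$. (H2a) If $K\le N-1$, then $$\Big(\frac{2(K+1)\gamma_{K+1}}{N}\Big)^N\Big(\frac{K-1}{2\gamma_N}\Big)^{K-1}\vee\Big(\frac{2K\gamma_K}{N-1}\Big)^{N-1}\Big(\frac{K-2}{2\gamma_{N-1}}\Big)^{K-2}\le\frac1{(N-K+1)^{N-K+1}},$$ where both inequalities are understood with the denominators $(2\gamma_N)^{K-1}$ and $(2\gamma_{N-1})^{K-2}$ multiplied out, so that $\gamma_N$ or $\gamma_{N-1}$ may vanish. (H2b) If $K=N$, then $\gamma_N\le\dfrac1{2(N-2)^{(N-2)/2}}$. If $r\ge1$ and $\phi$ satisfies (H), then for all $a\in(a_\phi,1)$,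 $$\chi_2\big(af*\sqrt{1-a^2}\,\phi\big)\le a^{r+1}\big(1+d_\phi(a)\big)\chi_2(f)+(1-a^2)^{\frac{r+1}2}\chi_2(\phi).$$ Moreover (for every $r\ge0$, and without (H)), the limit $\lim_{a\to1^-}|\log a|^{-\frac{r+1}2}d_\phi(a)$ exists and is finite. -/

import Mathlib

open MeasureTheory ProbabilityTheory Filter Topology
open scoped ENNReal

noncomputable section

/-- The standard normal distribution `μ` on the real line. -/
abbrev stdNormal : Measure ℝ := gaussianReal 0 1

/-- The distribution `f · μ` with density `f` with respect to the standard normal distribution. -/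
def withDens (f : ℝ → ℝ) : Measure ℝ :=
  stdNormal.withDensity (fun x => ENNReal.ofReal (f x))

/-- `f` is a probability density with respect to `μ` that belongs to `L²(μ)`. -/
structure IsL2Density (f : ℝ → ℝ) : Prop where
  memLp : MemLp f 2 stdNormal
  nonneg : ∀ᵐ x ∂stdNormal, 0 ≤ f x
  integral_eq_one : ∫ x, f x ∂stdNormal = 1

/-- The moments of `f · μ` match the moments of `μ` up to order `r`
(for `f ∈ L²(μ)` all the integrals converge). -/
def MomentsMatch (f : ℝ → ℝ) (r : ℕ) : Prop :=
  ∀ k : ℕ, 1 ≤ k → k ≤ r → ∫ x, x ^ k * f x ∂stdNormal = ∫ x, x ^ k ∂stdNormal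

/-- The `χ₂`-distance `(∫ (dθ/dν - 1)² dν)^{1/2}` between two distributions, `+∞` if `θ` is not
absolutely continuous with respect to `ν`. -/
def chi2Dist (θ ν : Measure ℝ) : ℝ≥0∞ :=
  open Classical in
  if θ ≪ ν then
    (∫⁻ x, ENNReal.ofReal (((θ.rnDeriv ν x).toReal - 1) ^ 2) ∂ν) ^ (1 / 2 : ℝ)
  else ⊤

/-- `χ₂(f) = χ₂(f · μ, μ)`. -/
def chi2 (f : ℝ → ℝ) : ℝ≥0∞ := chi2Dist (withDens f) stdNormal

/-- The law of `a U + b V` for independent `U ∼ f · μ` and `V ∼ φ · μ`; its density with respect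
to `μ` is `a f * b φ`. -/
def convLaw (a b : ℝ) (f φ : ℝ → ℝ) : Measure ℝ :=
  ((withDens f).prod (withDens φ)).map (fun p : ℝ × ℝ => a * p.1 + b * p.2)

/-- The normalized (probabilists') Hermite polynomial
`x ↦ (-1)ⁿ (n!)^{-1/2} e^{x²/2} Dⁿ(e^{-x²/2})`. -/
def normHermite (n : ℕ) (x : ℝ) : ℝ :=
  Polynomial.aeval x (Polynomial.hermite n) / Real.sqrt (n.factorial : ℝ)

/-- The `k`-th coefficient of `g` on the orthonormal Hermite basis of `L²(μ)`. -/
def hermiteCoeff (g : ℝ → ℝ) (k : ℕ) : ℝ :=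
  ∫ x, g x * normHermite k x ∂stdNormal

/-- `γ_k = C_k |c_k| / √(k!)` with `C_k = (1 + N/K)^{k/2}`. -/
def gammaCoeff (K N : ℕ) (c : ℕ → ℝ) (k : ℕ) : ℝ :=
  (1 + (N : ℝ) / K) ^ ((k : ℝ) / 2) * |c k| / Real.sqrt (k.factorial : ℝ)

/-- Hypothesis (H) on the coefficients `c_K, …, c_N`, for `K ≥ 2`.  In (H2a) the inequalities
`(2(K+1)γ_{K+1}/N)^N ((K-1)/(2γ_N))^{K-1} ≤ (N-K+1)^{-(N-K+1)}` and
`(2Kγ_K/(N-1))^{N-1} ((K-2)/(2γ_{N-1}))^{K-2} ≤ (N-K+1)^{-(N-K+1)}`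
are written without the denominators `γ_N`, `γ_{N-1}`, which may vanish. -/
structure HypothesisH (K N : ℕ) (c : ℕ → ℝ) : Prop where
  h1 : ∀ k : ℕ, K ≤ k → k + 2 ≤ N →
    ((k : ℝ) + 2) * gammaCoeff K N c (k + 2) ≤ gammaCoeff K N c k
  h2a_left : K + 1 ≤ N →
    (2 * ((K : ℝ) + 1) * gammaCoeff K N c (K + 1) / N) ^ N * ((K : ℝ) - 1) ^ (K - 1)
        * ((N : ℝ) - K + 1) ^ (N - K + 1)
      ≤ (2 * gammaCoeff K N c N) ^ (K - 1)
  h2a_right : K + 1 ≤ N →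
    (2 * (K : ℝ) * gammaCoeff K N c K / ((N : ℝ) - 1)) ^ (N - 1) * ((K : ℝ) - 2) ^ (K - 2)
        * ((N : ℝ) - K + 1) ^ (N - K + 1)
      ≤ (2 * gammaCoeff K N c (N - 1)) ^ (K - 2)
  h2b : K = N →
    gammaCoeff K N c N ≤ 1 / (2 * ((N : ℝ) - 2) ^ (((N : ℝ) - 2) / 2))

/-- `a_φ = (1 + N/(r+1))^{-1/4}`. -/
def aThreshold (r N : ℕ) : ℝ := (1 + (N : ℝ) / ((r : ℝ) + 1)) ^ (-(1 / 4) : ℝ)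

/-- `d_φ(a) = ∑_{k=r+1}^N |φ_k| (k!)^{-1/2} (-2 (r+1+N) (1 + N/(r+1)) log a)^{k/2}`. -/
def dFun (r N : ℕ) (c : ℕ → ℝ) (a : ℝ) : ℝ :=
  ∑ k ∈ Finset.Icc (r + 1) N,
    |c k| / Real.sqrt (k.factorial : ℝ)
      * (-2 * ((r : ℝ) + 1 + N) * (1 + (N : ℝ) / ((r : ℝ) + 1)) * Real.log a) ^ ((k : ℝ) / 2)

end

/-! In the Hermite basis `chi2` is the norm of `f - 1`, that is, the `ℓ²` norm of the coefficients
of positive order. For `a² + b² = 1` the addition formula `normHermite_add` gives the `n`-th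
coefficient of the law of `aU + bV` as the sum over `k + j = n` of `√(n choose k) a^k b^j f_k φ_j`.
The terms with `k = 0` are `b^n φ_n`; they vanish for `1 ≤ n ≤ r` and give the second summand of the
bound. Since `f_k = 0` for `1 ≤ k ≤ r`, the rest is a lower triangular matrix acting on the `f_k`
with `k ≥ K = r + 1`.

Its norm is estimated by Schur's test (`sum_sq_antidiagonal_le`). From `n choose j ≤ n^j / j!` and
`1 - a² ≤ -2 log a`, the sum of row or column `m` is at most `a^m (1 + ∑ γ_k y^k)` with `y = √(-2 m
log a)`. As `a^m = exp (-y²/2)`, this is one fixed function of `y`. Hypothesis (H) makes that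
function decreasing on `y ≥ 0` (`HypothesisH.antitoneOn`), so the worst index is `m = K`, which
yields `a^K (1 + d_φ(a))`.

These estimates concern sequences only. Riesz–Fischer produces an `L²` function with the computed
coefficients, and `eq_withDens_of_hermite_moments` shows, by moment determinacy, that it is the
density of the law of `aU + bV`. -/

/-! ### Polynomials under the Gaussian measure -/

/-- Polynomials belong to `L^p` of the standard normal distribution for all finite `p`. -/
lemma memLp_pow_stdNormal (n : ℕ) : ∀ {p : ℝ≥0∞}, p ≠ ∞ → MemLp (fun x : ℝ => x ^ n) p stdNormal := by
  induction n with
  | zero => intro p _; simpa using memLp_const (1 : ℝ)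
  | succ n ih =>
    intro p hp
    have hp2 : 2 * p ≠ ∞ := ENNReal.mul_ne_top (by simp) hp
    have h1 : MemLp (fun x : ℝ => x) (2 * p) stdNormal := memLp_id_gaussianReal' _ hp2
    have : ENNReal.HolderTriple (2 * p) (2 * p) p := ⟨by
      rw [ENNReal.mul_inv (by simp) (by simp), ← add_mul, ENNReal.inv_two_add_inv_two, one_mul]⟩
    simpa [pow_succ] using! h1.mul' (ih hp2)

lemma memLp_polynomial_stdNormal (P : Polynomial ℝ) {p : ℝ≥0∞} (hp : p ≠ ∞) :
    MemLp (fun x => P.eval x) p stdNormal := by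
  simp_rw [Polynomial.eval_eq_sum_range]
  exact memLp_finsetSum _ fun i _ => (memLp_pow_stdNormal i hp).const_mul _

lemma integrable_polynomial_stdNormal (P : Polynomial ℝ) :
    Integrable (fun x => P.eval x) stdNormal :=
  memLp_one_iff_integrable.1 (memLp_polynomial_stdNormal P (by simp))

lemma integrable_mul_polynomial {f : ℝ → ℝ} (hf : MemLp f 2 stdNormal) (P : Polynomial ℝ) :
    Integrable (fun x => f x * P.eval x) stdNormal :=
  hf.integrable_mul (memLp_polynomial_stdNormal P (p := 2) ENNReal.ofNat_ne_top)

lemma hasDerivAt_gaussianPDFReal (x : ℝ) :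
    HasDerivAt (gaussianPDFReal 0 1) (-x * gaussianPDFReal 0 1 x) x := by
  have h : HasDerivAt (fun x : ℝ => (√(2 * Real.pi))⁻¹ * Real.exp (-x ^ 2 / 2))
      ((√(2 * Real.pi))⁻¹ * (Real.exp (-x ^ 2 / 2) * (-(2 * x) / 2))) x := by
    refine HasDerivAt.const_mul _ (HasDerivAt.exp ?_)
    simpa using ((hasDerivAt_pow 2 x).neg.div_const 2)
  convert h using 1
  · ext y; simp [gaussianPDFReal]
  · simp [gaussianPDFReal]; ring

/-- Stein's identity for polynomials. -/
lemma integral_id_mul_polynomial_stdNormal (P : Polynomial ℝ) :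
    ∫ x, x * P.eval x ∂stdNormal = ∫ x, P.derivative.eval x ∂stdNormal := by
  have hint (Q : Polynomial ℝ) : Integrable (fun x => gaussianPDFReal 0 1 x * Q.eval x) := by
    have h := integrable_polynomial_stdNormal Q
    rw [stdNormal, gaussianReal_of_var_ne_zero _ one_ne_zero,
      integrable_withDensity_iff_integrable_smul₀' (by fun_prop)
        (by simp [gaussianPDF])] at h
    simpa [toReal_gaussianPDF] using! h
  have key := integral_eq_zero_of_hasDerivAt_of_integrable
    (f := fun x => gaussianPDFReal 0 1 x * P.eval x)
    (f' := fun x => gaussianPDFReal 0 1 x * (P.derivative - Polynomial.X * P).eval x)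
    (fun x => ((hasDerivAt_gaussianPDFReal x).mul (P.hasDerivAt x)).congr_deriv (by
      simp; ring)) (hint _) (hint _)
  have h2 : ∫ x, (P.derivative - Polynomial.X * P).eval x ∂stdNormal = 0 := by
    rw [stdNormal, integral_gaussianReal_eq_integral_smul one_ne_zero]
    simpa using key
  have h3 := integral_sub (integrable_polynomial_stdNormal P.derivative)
    (integrable_polynomial_stdNormal (Polynomial.X * P))
  simp only [Polynomial.eval_sub] at h2
  rw [h2] at h3
  simp only [Polynomial.eval_mul, Polynomial.eval_X] at h3
  linarith

/-! ### Hermite polynomials: orthogonality and spanning -/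

/-- The Hermite polynomials over the reals. -/
noncomputable def realHermite (n : ℕ) : Polynomial ℝ := (Polynomial.hermite n).map (Int.castRingHom ℝ)

lemma realHermite_zero : realHermite 0 = 1 := by simp [realHermite]

lemma realHermite_succ (n : ℕ) :
    realHermite (n + 1) = Polynomial.X * realHermite n - (realHermite n).derivative := by
  simp [realHermite, Polynomial.derivative_map]

lemma realHermite_monic (n : ℕ) : (realHermite n).Monic := (Polynomial.hermite_monic n).map _

lemma natDegree_realHermite (n : ℕ) : (realHermite n).natDegree = n := by
  rw [realHermite, (Polynomial.hermite_monic n).natDegree_map, Polynomial.natDegree_hermite]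

lemma derivative_realHermite_succ (n : ℕ) :
    (realHermite (n + 1)).derivative = ((n : Polynomial ℝ) + 1) * realHermite n := by
  induction n with
  | zero => simp [realHermite_succ, realHermite_zero]
  | succ n ih =>
    rw [realHermite_succ (n + 1), Polynomial.derivative_sub, Polynomial.derivative_mul, ih,
      Polynomial.derivative_X, Polynomial.derivative_mul, realHermite_succ n]
    simp
    ring

/-- Repeated integration by parts: Stein's identity for `He_n P`, combined with `He_{n+1} = x He_n -
He_n'`, moves one derivative onto `P` each time. Orthogonality and the norms follow by counting
degrees. -/
lemma integral_realHermite_mul (n : ℕ) (P : Polynomial ℝ) :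
    ∫ x, (realHermite n).eval x * P.eval x ∂stdNormal
      = ∫ x, (Polynomial.derivative^[n] P).eval x ∂stdNormal := by
  induction n generalizing P with
  | zero => simp [realHermite_zero]
  | succ n ih =>
    have h := integral_id_mul_polynomial_stdNormal (realHermite n * P)
    rw [Function.iterate_succ_apply, ← ih, realHermite_succ]
    have h3 := integral_sub (integrable_polynomial_stdNormal (Polynomial.X * (realHermite n * P)))
      (integrable_polynomial_stdNormal ((realHermite n).derivative * P))
    have h4 := integral_add (integrable_polynomial_stdNormal ((realHermite n).derivative * P))
      (integrable_polynomial_stdNormal (realHermite n * P.derivative))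
    simp only [Polynomial.derivative_mul, Polynomial.eval_add, Polynomial.eval_mul,
      Polynomial.eval_X, Polynomial.eval_sub] at h h3 h4 ⊢
    rw [h4] at h
    rw [h] at h3
    rw [add_sub_cancel_left] at h3
    rw [← h3]
    congr 1; ext x; ring

lemma integral_realHermite_mul_of_natDegree_lt {n : ℕ} {P : Polynomial ℝ} (h : P.natDegree < n) :
    ∫ x, (realHermite n).eval x * P.eval x ∂stdNormal = 0 := by
  rw [integral_realHermite_mul, Polynomial.iterate_derivative_eq_zero h]; simp

lemma integral_realHermite_mul_self (n : ℕ) :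
    ∫ x, (realHermite n).eval x * (realHermite n).eval x ∂stdNormal = n.factorial := by
  have h : ∀ n : ℕ, Polynomial.derivative^[n] (realHermite n) = (n.factorial : Polynomial ℝ) := by
    intro n
    induction n with
    | zero => simp [realHermite_zero]
    | succ n ih =>
      have : ((n : Polynomial ℝ) + 1) = ((n + 1 : ℕ) : Polynomial ℝ) := by push_cast; rfl
      rw [Function.iterate_succ_apply, derivative_realHermite_succ, this,
        Polynomial.iterate_derivative_natCast_mul, ih, Nat.factorial_succ]
      push_cast; rfl
  rw [integral_realHermite_mul, h]
  simp

lemma integral_realHermite_mul_realHermite (m n : ℕ) :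
    ∫ x, (realHermite m).eval x * (realHermite n).eval x ∂stdNormal
      = if m = n then (n.factorial : ℝ) else 0 := by
  split_ifs with h
  · rw [h, integral_realHermite_mul_self]
  · rcases lt_or_gt_of_ne h with h | h
    · simp_rw [mul_comm (Polynomial.eval _ (realHermite m))]
      exact integral_realHermite_mul_of_natDegree_lt (by rwa [natDegree_realHermite])
    · exact integral_realHermite_mul_of_natDegree_lt (by rwa [natDegree_realHermite])

lemma normHermite_eq (n : ℕ) (x : ℝ) :
    normHermite n x = (Polynomial.C (√(n.factorial : ℝ))⁻¹ * realHermite n).eval x := by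
  simp [normHermite, realHermite, Polynomial.aeval_def, Polynomial.eval_map, div_eq_inv_mul]

lemma memLp_normHermite (n : ℕ) : MemLp (normHermite n) 2 stdNormal := by
  rw [funext (normHermite_eq n)]
  exact memLp_polynomial_stdNormal _ (by simp)

lemma normHermite_zero (x : ℝ) : normHermite 0 x = 1 := by
  simp [normHermite]

lemma integral_normHermite_mul_normHermite (m n : ℕ) :
    ∫ x, normHermite m x * normHermite n x ∂stdNormal = if m = n then 1 else 0 := by
  simp only [normHermite_eq, Polynomial.eval_mul, Polynomial.eval_C]
  have : ∀ x : ℝ, (√(m.factorial : ℝ))⁻¹ * (realHermite m).eval x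
      * ((√(n.factorial : ℝ))⁻¹ * (realHermite n).eval x)
      = ((√(m.factorial : ℝ))⁻¹ * (√(n.factorial : ℝ))⁻¹) *
        ((realHermite m).eval x * (realHermite n).eval x) := fun x => by ring
  simp_rw [this]
  rw [integral_const_mul, integral_realHermite_mul_realHermite]
  split_ifs with h
  · subst h
    have h0 : (0 : ℝ) < m.factorial := by positivity
    rw [← mul_inv, Real.mul_self_sqrt h0.le, inv_mul_cancel₀ h0.ne']
  · simp

/-- Each `He_n` is monic of degree `n`, so subtracting a multiple of it removes the leading term. -/
lemma exists_eq_sum_normHermite (P : Polynomial ℝ) : ∃ c : ℕ → ℝ, ∀ x,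
    P.eval x = ∑ k ∈ Finset.range (P.natDegree + 1), c k * normHermite k x := by
  suffices H : ∀ n : ℕ, ∀ P : Polynomial ℝ, P.natDegree < n → ∃ c : ℕ → ℝ, ∀ x,
      P.eval x = ∑ k ∈ Finset.range n, c k * normHermite k x from H _ P (Nat.lt_succ_self _)
  intro n
  induction n with
  | zero => intro P h; omega
  | succ n ih =>
    intro P hP
    rcases Nat.eq_zero_or_pos n with rfl | hn
    · refine ⟨fun _ => P.coeff 0, fun x => ?_⟩
      rw [Polynomial.eq_C_of_natDegree_le_zero (Nat.lt_succ_iff.1 hP)]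
      simp [normHermite_zero]
    have hlt : (P - Polynomial.C (P.coeff n) * realHermite n).natDegree < n := by
      refine Nat.lt_of_le_pred hn (Polynomial.natDegree_le_iff_coeff_eq_zero.2 fun m hm => ?_)
      rcases Nat.eq_or_lt_of_le (show n ≤ m by rw [Nat.pred_eq_sub_one] at hm; omega) with h | h
      · subst h
        have h1 : (realHermite n).coeff n = 1 := by
          simpa [natDegree_realHermite] using (realHermite_monic n).coeff_natDegree
        simp [h1]
      · have h1 : (realHermite n).coeff m = 0 :=
          Polynomial.coeff_eq_zero_of_natDegree_lt (by rwa [natDegree_realHermite])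
        have h2 : P.coeff m = 0 := Polynomial.coeff_eq_zero_of_natDegree_lt (by omega)
        simp [h1, h2]
    obtain ⟨c, hc⟩ := ih _ hlt
    have h0 : √(n.factorial : ℝ) ≠ 0 := by positivity
    refine ⟨fun k => if k = n then P.coeff n * √(n.factorial : ℝ) else c k, fun x => ?_⟩
    rw [Finset.sum_range_succ, Finset.sum_congr rfl
      (g := fun k => c k * normHermite k x), ← hc, normHermite_eq]
    · simp; field_simp; ring
    · intro k hk
      simp [(Finset.mem_range.1 hk).ne]

/-! ### Generating series and the addition formula -/

/-- The generating series `∑ Heₙ(x) tⁿ / n!`. -/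
noncomputable def hermiteSeries (x : ℝ) : PowerSeries ℝ :=
  PowerSeries.mk fun n => (realHermite n).eval x / n.factorial

/-- The formal differential equation of `exp (xT - T²/2)`; with the constant coefficient it
determines the series. -/
lemma derivative_hermiteSeries (x : ℝ) :
    PowerSeries.derivative ℝ (hermiteSeries x)
      = (PowerSeries.C x - PowerSeries.X) * hermiteSeries x := by
  ext n
  rw [PowerSeries.coeff_derivative, sub_mul, map_sub, PowerSeries.coeff_C_mul]
  cases n with
  | zero => simp [hermiteSeries, realHermite_succ, realHermite_zero]
  | succ n =>
    rw [PowerSeries.coeff_succ_X_mul]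
    simp only [hermiteSeries, PowerSeries.coeff_mk]
    rw [realHermite_succ (n + 1), derivative_realHermite_succ, Nat.factorial_succ (n + 1),
      Nat.factorial_succ n]
    have : (n.factorial : ℝ) ≠ 0 := by positivity
    have : (n : ℝ) + 1 ≠ 0 := by positivity
    have : (n : ℝ) + 1 + 1 ≠ 0 := by positivity
    simp
    field_simp

lemma derivative_rescale (a : ℝ) (F : PowerSeries ℝ) :
    PowerSeries.derivative ℝ (PowerSeries.rescale a F)
      = PowerSeries.C a * PowerSeries.rescale a (PowerSeries.derivative ℝ F) := by
  ext n
  simp [PowerSeries.coeff_derivative, PowerSeries.coeff_rescale, pow_succ]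
  ring

/-- Both sides solve the same first-order equation with constant coefficient 1. The product rule
yields the factor `au + bv - (a² + b²)T`, hence the condition on `a` and `b`. -/
lemma rescale_hermiteSeries_mul {a b : ℝ} (hab : a ^ 2 + b ^ 2 = 1) (u v : ℝ) :
    PowerSeries.rescale a (hermiteSeries u) * PowerSeries.rescale b (hermiteSeries v)
      = hermiteSeries (a * u + b * v) := by
  set F := PowerSeries.rescale a (hermiteSeries u) * PowerSeries.rescale b (hermiteSeries v) with hF
  have hr (c : ℝ) : PowerSeries.rescale c (PowerSeries.X : PowerSeries ℝ)
      = PowerSeries.C c * PowerSeries.X := by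
    ext n; simp [PowerSeries.coeff_X]
  have hC (c d : ℝ) : PowerSeries.rescale c (PowerSeries.C d : PowerSeries ℝ)
      = PowerSeries.C d := by
    ext n; simp only [PowerSeries.coeff_rescale, PowerSeries.coeff_C]; split_ifs with h <;> simp [h]
  have hFd : PowerSeries.derivative ℝ F
      = (PowerSeries.C (a * u + b * v) - PowerSeries.X) * F := by
    have h1 : (PowerSeries.C a : PowerSeries ℝ) ^ 2 + (PowerSeries.C b) ^ 2 = 1 := by
      rw [← map_pow, ← map_pow, ← map_add, hab, map_one]
    rw [hF, Derivation.leibniz, derivative_rescale, derivative_rescale, derivative_hermiteSeries,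
      derivative_hermiteSeries]
    simp only [map_mul, map_sub, hr, hC, smul_eq_mul, map_add]
    linear_combination (- PowerSeries.X * PowerSeries.rescale a (hermiteSeries u)
      * PowerSeries.rescale b (hermiteSeries v)) * h1
  have hd := derivative_hermiteSeries (a * u + b * v)
  have h0 : PowerSeries.coeff 0 F = PowerSeries.coeff 0 (hermiteSeries (a * u + b * v)) := by
    simp [hF, PowerSeries.coeff_mul, PowerSeries.coeff_rescale, hermiteSeries, realHermite_zero]
  have step (n : ℕ) {G : PowerSeries ℝ} {s : ℝ}
      (hG : PowerSeries.derivative ℝ G = (PowerSeries.C s - PowerSeries.X) * G) :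
      PowerSeries.coeff (n + 1) G = (s * PowerSeries.coeff n G
        - PowerSeries.coeff n (PowerSeries.X * G)) / (n + 1) := by
    have := congrArg (PowerSeries.coeff n) hG
    rw [PowerSeries.coeff_derivative, sub_mul, map_sub, PowerSeries.coeff_C_mul] at this
    rw [← this]
    field_simp
  ext n
  induction n using Nat.strong_induction_on with
  | _ n ih =>
    rcases n with _ | n
    · exact h0
    · rw [step n hFd, step n hd, ih n (Nat.lt_succ_self n)]
      rcases n with _ | n
      · simp
      · rw [PowerSeries.coeff_succ_X_mul, PowerSeries.coeff_succ_X_mul, ih n (by omega)]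

/-- The addition formula for the normalized Hermite polynomials. -/
lemma normHermite_add {a b : ℝ} (hab : a ^ 2 + b ^ 2 = 1) (u v : ℝ) (n : ℕ) :
    normHermite n (a * u + b * v) = ∑ p ∈ Finset.HasAntidiagonal.antidiagonal n,
      √((p.1 + p.2).choose p.1 : ℝ) * a ^ p.1 * b ^ p.2
        * (normHermite p.1 u * normHermite p.2 v) := by
  have h := congrArg (PowerSeries.coeff n) (rescale_hermiteSeries_mul hab u v)
  rw [PowerSeries.coeff_mul] at h
  have hn : normHermite n (a * u + b * v)
      = √(n.factorial : ℝ) * ((realHermite n).eval (a * u + b * v) / n.factorial) := by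
    rw [normHermite_eq]
    simp only [Polynomial.eval_mul, Polynomial.eval_C]
    have : (0 : ℝ) < n.factorial := by positivity
    rw [inv_mul_eq_div, mul_div_assoc', div_eq_div_iff (by positivity) this.ne', mul_comm _ (n.factorial : ℝ),
      mul_right_comm, Real.mul_self_sqrt this.le]
  simp only [hermiteSeries, PowerSeries.coeff_rescale, PowerSeries.coeff_mk] at h
  rw [hn, ← h, Finset.mul_sum]
  refine Finset.sum_congr rfl fun p hp => ?_
  rw [Finset.HasAntidiagonal.mem_antidiagonal] at hp
  subst hp
  have hk : (0 : ℝ) < p.1.factorial := by positivity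
  have hj : (0 : ℝ) < p.2.factorial := by positivity
  have hc : √((p.1 + p.2).choose p.1 : ℝ)
      = √((p.1 + p.2).factorial : ℝ) / (√(p.1.factorial : ℝ) * √(p.2.factorial : ℝ)) := by
    rw [Nat.cast_add_choose, Real.sqrt_div (by positivity), Real.sqrt_mul hk.le]
  rw [hc, normHermite_eq, normHermite_eq]
  simp only [Polynomial.eval_mul, Polynomial.eval_C]
  have e1 := Real.mul_self_sqrt hk.le
  have e2 := Real.mul_self_sqrt hj.le
  have h1 : √(p.1.factorial : ℝ) ≠ 0 := by positivity
  have h2 : √(p.2.factorial : ℝ) ≠ 0 := by positivity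
  generalize √(p.1.factorial : ℝ) = s at *
  generalize √(p.2.factorial : ℝ) = t at *
  rw [← e1, ← e2]
  field_simp

/-! ### Determinacy of the moment problem -/

/-- A finite measure on the line with all exponential moments is determined by its moments. -/
lemma ext_of_forall_integral_pow_eq {μ ν : Measure ℝ} [IsFiniteMeasure μ] [IsFiniteMeasure ν]
    (hμ : ∀ t : ℝ, Integrable (fun x => Real.exp (t * x)) μ)
    (hν : ∀ t : ℝ, Integrable (fun x => Real.exp (t * x)) ν)
    (h : ∀ n : ℕ, ∫ x, x ^ n ∂μ = ∫ x, x ^ n ∂ν) : μ = ν := by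
  have sμ : integrableExpSet id μ = Set.univ := Set.eq_univ_of_forall hμ
  have sν : integrableExpSet id ν = Set.univ := Set.eq_univ_of_forall hν
  have aμ : AnalyticOnNhd ℝ (mgf id μ) Set.univ := by
    simpa [sμ] using analyticOnNhd_mgf (X := id) (μ := μ)
  have aν : AnalyticOnNhd ℝ (mgf id ν) Set.univ := by
    simpa [sν] using analyticOnNhd_mgf (X := id) (μ := ν)
  have pμ := hasFPowerSeriesAt_mgf (X := id) (μ := μ) (v := 0) (by simp [sμ])
  have pν := hasFPowerSeriesAt_mgf (X := id) (μ := ν) (v := 0) (by simp [sν])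
  -- The moments are the Taylor data at 0, so the two moment generating functions agree near 0, and
  -- everywhere by analyticity.
  have hmgf : mgf id μ = mgf id ν := by
    refine aμ.eq_of_eventuallyEq aν (z₀ := 0) ?_
    have e : (fun n : ℕ => (∫ x, id x ^ n * Real.exp (0 * id x) ∂μ) / (n.factorial : ℝ))
        = fun n : ℕ => (∫ x, id x ^ n * Real.exp (0 * id x) ∂ν) / (n.factorial : ℝ) := by
      ext n; simp [h n]
    rw [e] at pμ
    filter_upwards [pμ.eventually_hasSum_sub, pν.eventually_hasSum_sub] with z h1 h2
    exact h1.unique h2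
  have h0 : μ = 0 ↔ ν = 0 := by
    have := h 0
    simp only [pow_zero, integral_const, smul_eq_mul, mul_one] at this
    rw [← Measure.measure_univ_eq_zero, ← Measure.measure_univ_eq_zero (μ := ν),
      ← measureReal_eq_zero_iff, ← measureReal_eq_zero_iff, this]
  refine Measure.ext_of_complexMGF_id_eq (funext fun z => ?_)
  exact eqOn_complexMGF_of_mgf' hmgf h0 (by simp [sμ])

/-! ### Hermite coefficients of densities -/

lemma integral_normHermite_of_pos {k : ℕ} (hk : 1 ≤ k) : ∫ x, normHermite k x ∂stdNormal = 0 := by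
  have := integral_normHermite_mul_normHermite k 0
  simpa [normHermite_zero, show k ≠ 0 by omega] using this

lemma integrable_mul_normHermite {f : ℝ → ℝ} (hf : MemLp f 2 stdNormal) (k : ℕ) :
    Integrable (fun x => f x * normHermite k x) stdNormal := by
  simp_rw [normHermite_eq]; exact integrable_mul_polynomial hf _

lemma hermiteCoeff_zero {f : ℝ → ℝ} (hf : IsL2Density f) : hermiteCoeff f 0 = 1 := by
  simp [hermiteCoeff, normHermite_zero, hf.integral_eq_one]

/-- Matching moments annihilate the corresponding Hermite coefficients. -/
lemma hermiteCoeff_eq_zero {f : ℝ → ℝ} {r k : ℕ} (hf : IsL2Density f) (hm : MomentsMatch f r)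
    (hk : 1 ≤ k) (hkr : k ≤ r) : hermiteCoeff f k = 0 := by
  rw [hermiteCoeff, ← integral_normHermite_of_pos hk]
  have hi : ∀ i, Integrable (fun x => f x * x ^ i) stdNormal := fun i => by
    simpa using integrable_mul_polynomial hf.memLp (Polynomial.X ^ i)
  have hi' : ∀ i, Integrable (fun x : ℝ => x ^ i) stdNormal := fun i => by
    simpa using integrable_polynomial_stdNormal (Polynomial.X ^ i)
  simp_rw [normHermite_eq, Polynomial.eval_mul, Polynomial.eval_C, Polynomial.eval_eq_sum_range,
    natDegree_realHermite, Finset.mul_sum, mul_left_comm (f _)]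
  rw [integral_finsetSum, integral_finsetSum]
  · refine Finset.sum_congr rfl fun i hi => ?_
    simp_rw [integral_const_mul]
    rcases Nat.eq_zero_or_pos i with rfl | h0
    · simp [hf.integral_eq_one]
    · rw [← hm i h0 (by rw [Finset.mem_range] at hi; omega)]
      simp_rw [mul_comm (f _)]
  · exact fun i _ => ((hi' i).const_mul _).const_mul _
  · exact fun i _ => ((hi i).const_mul _).const_mul _

/-- A polynomial is the sum of its Hermite expansion. -/
lemma eval_eq_sum_hermiteCoeff (P : Polynomial ℝ) (x : ℝ) :
    P.eval x = ∑ k ∈ Finset.range (P.natDegree + 1),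
      hermiteCoeff (fun y => P.eval y) k * normHermite k x := by
  obtain ⟨c, hc⟩ := exists_eq_sum_normHermite P
  rw [hc x]
  refine Finset.sum_congr rfl fun k hk => ?_
  congr 1
  simp_rw [hermiteCoeff, hc, Finset.sum_mul]
  rw [integral_finsetSum]
  · simp_rw [mul_assoc, integral_const_mul, integral_normHermite_mul_normHermite]
    simp [Finset.mem_range.1 hk]
  · intro i _
    simp_rw [mul_assoc]
    exact (integrable_mul_normHermite (memLp_normHermite i) k).const_mul _

lemma hermiteCoeff_polynomial_eq_zero {P : Polynomial ℝ} {k : ℕ} (hk : P.natDegree < k) :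
    hermiteCoeff (fun y => P.eval y) k = 0 := by
  simp_rw [hermiteCoeff, normHermite_eq, Polynomial.eval_mul, Polynomial.eval_C,
    mul_left_comm (P.eval _), integral_const_mul, mul_comm (P.eval _)]
  rw [integral_realHermite_mul_of_natDegree_lt hk, mul_zero]

lemma eval_eq_one_add_sum_hermiteCoeff {r N : ℕ} {φ : Polynomial ℝ}
    (hφ : IsL2Density (fun x => φ.eval x)) (hφm : MomentsMatch (fun x => φ.eval x) r)
    (hN : φ.natDegree ≤ N) (x : ℝ) :
    φ.eval x = 1 + ∑ k ∈ Finset.Icc (r + 1) N,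
      hermiteCoeff (fun y => φ.eval y) k * normHermite k x := by
  have h0 : hermiteCoeff (fun y => φ.eval y) 0 * normHermite 0 x = 1 := by
    rw [hermiteCoeff_zero hφ, normHermite_zero, one_mul]
  rw [eval_eq_sum_hermiteCoeff φ x, ← h0, ← Finset.sum_insert (s := Finset.Icc (r + 1) N) (a := 0)
    (f := fun k => hermiteCoeff (fun y => φ.eval y) k * normHermite k x) (by simp)]
  trans ∑ k ∈ Finset.range (N + 1), hermiteCoeff (fun y => φ.eval y) k * normHermite k x
  · refine Finset.sum_subset (fun k => by simp; omega) fun k _ hk => ?_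
    rw [hermiteCoeff_polynomial_eq_zero (by simp at hk; omega), zero_mul]
  · refine (Finset.sum_subset (fun k => by simp; omega) fun k hk hk' => ?_).symm
    simp only [Finset.mem_insert, Finset.mem_Icc, Finset.mem_range] at hk hk'
    rw [hermiteCoeff_eq_zero hφ hφm (by omega) (by omega), zero_mul]

/-! ### Hypothesis (H) as a monotonicity statement -/

/-- Weighted AM-GM with weights `d/p` and `q/p`, the two points chosen so that the arithmetic mean
is exactly `1 + A y^p`. This is where the shape of (H2a) and (H2b) comes from. -/
lemma mul_pow_le_one_add_of_pow_le {p q d : ℕ} (hd : 0 < d) (hp : d + q = p) {A B y : ℝ}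
    (hA : 0 ≤ A) (hy : 0 ≤ y)
    (h : (B / p) ^ p * (q : ℝ) ^ q * (d : ℝ) ^ d ≤ A ^ q) : B * y ^ q ≤ 1 + A * y ^ p := by
  have hp0 : 0 < p := by omega
  have hpR : (0 : ℝ) < p := by exact_mod_cast hp0
  have hdR : (0 : ℝ) < d := by exact_mod_cast hd
  -- The case `q = 0` occurs for `K = 2`; the AM-GM point below would divide by zero.
  rcases Nat.eq_zero_or_pos q with rfl | hq
  · obtain rfl : d = p := by omega
    have h1 : B ^ d ≤ 1 ^ d := by
      have : (B / d) ^ d * (d : ℝ) ^ d = B ^ d := by rw [← mul_pow]; congr 1; field_simp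
      simpa [this] using h
    have h2 : B ≤ 1 := le_of_pow_le_pow_left₀ hd.ne' zero_le_one h1
    have : 0 ≤ A * y ^ d := by positivity
    simpa using h2.trans (by linarith)
  have hqR : (0 : ℝ) < q := by exact_mod_cast hq
  have hdq : (d : ℝ) + q = p := by exact_mod_cast hp
  have am := Real.geom_mean_le_arith_mean2_weighted (w₁ := d / p) (w₂ := q / p)
    (p₁ := p / d) (p₂ := A * y ^ p * p / q) (by positivity) (by positivity) (by positivity)
    (by positivity) (by rw [← add_div, hdq, div_self hpR.ne'])
  have e : (d / p : ℝ) * (p / d) + q / p * (A * y ^ p * p / q) = 1 + A * y ^ p := by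
    field_simp
  rw [e] at am
  refine le_trans ?_ am
  refine le_of_pow_le_pow_left₀ hp0.ne' (by positivity) ?_
  rw [mul_pow ((p / d : ℝ) ^ _)]
  have r1 {z : ℝ} (hz : 0 ≤ z) (m : ℕ) : (z ^ ((m : ℝ) / p)) ^ p = z ^ m := by
    rw [← Real.rpow_natCast, ← Real.rpow_mul hz, div_mul_cancel₀ _ hpR.ne', Real.rpow_natCast]
  rw [r1 (by positivity), r1 (by positivity)]
  have h' : B ^ p * ((q : ℝ) ^ q * (d : ℝ) ^ d) ≤ A ^ q * (p : ℝ) ^ p := by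
    rw [div_pow, mul_assoc, div_mul_eq_mul_div, div_le_iff₀ (by positivity)] at h
    exact h
  calc (B * y ^ q) ^ p = (B ^ p * ((q : ℝ) ^ q * (d : ℝ) ^ d)) * (y ^ p) ^ q
        / ((q : ℝ) ^ q * (d : ℝ) ^ d) := by
        rw [mul_pow, ← pow_mul, ← pow_mul, mul_comm q p]; field_simp
    _ ≤ (A ^ q * (p : ℝ) ^ p) * (y ^ p) ^ q / ((q : ℝ) ^ q * (d : ℝ) ^ d) := by gcongr
    _ = (p / d : ℝ) ^ d * (A * y ^ p * p / q) ^ q := by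
        have : (p : ℝ) ^ p = (p : ℝ) ^ d * (p : ℝ) ^ q := by rw [← pow_add, hp]
        rw [this]
        simp only [div_pow, mul_pow]
        field_simp

lemma gammaCoeff_nonneg (K N : ℕ) (c : ℕ → ℝ) (k : ℕ) : 0 ≤ gammaCoeff K N c k := by
  unfold gammaCoeff; positivity

/-- Each half of (H2a) bounds twice one term on the left by `y` plus twice one term on the right;
the claim is their average. -/
lemma HypothesisH.first_terms_le {K N : ℕ} {c : ℕ → ℝ} (H : HypothesisH K N c) (hK : 2 ≤ K)
    (hN : K + 1 ≤ N) {y : ℝ} (hy : 0 ≤ y) :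
    K * gammaCoeff K N c K * y ^ (K - 1) + (K + 1) * gammaCoeff K N c (K + 1) * y ^ K
      ≤ y + gammaCoeff K N c (N - 1) * y ^ N + gammaCoeff K N c N * y ^ (N + 1) := by
  have g0 := gammaCoeff_nonneg K N c
  have c1 : ((K - 1 : ℕ) : ℝ) = (K : ℝ) - 1 := by push_cast [show 1 ≤ K by omega]; ring
  have c2 : ((K - 2 : ℕ) : ℝ) = (K : ℝ) - 2 := by push_cast [hK]; ring
  have c3 : ((N - K + 1 : ℕ) : ℝ) = (N : ℝ) - K + 1 := by push_cast [show K ≤ N by omega]; ring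
  have c4 : ((N - 1 : ℕ) : ℝ) = (N : ℝ) - 1 := by push_cast [show 1 ≤ N by omega]; ring
  have l := mul_pow_le_one_add_of_pow_le (p := N) (q := K - 1) (d := N - K + 1) (by omega)
    (by omega) (A := 2 * gammaCoeff K N c N) (B := 2 * ((K : ℝ) + 1) * gammaCoeff K N c (K + 1))
    (by linarith [g0 N]) hy
    (by rw [c1, c3]; exact H.h2a_left hN)
  have r := mul_pow_le_one_add_of_pow_le (p := N - 1) (q := K - 2) (d := N - K + 1) (by omega)
    (by omega) (A := 2 * gammaCoeff K N c (N - 1)) (B := 2 * (K : ℝ) * gammaCoeff K N c K)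
    (by linarith [g0 (N - 1)]) hy
    (by rw [c2, c3, c4]; exact H.h2a_right hN)
  have l' := mul_le_mul_of_nonneg_right l hy
  have r' := mul_le_mul_of_nonneg_right r hy
  have e1 : y ^ (K - 1) * y = y ^ K := by rw [← pow_succ]; congr 1; omega
  have e2 : y ^ (K - 2) * y = y ^ (K - 1) := by rw [← pow_succ]; congr 1; omega
  have e3 : y ^ (N - 1) * y = y ^ N := by rw [← pow_succ]; congr 1; omega
  rw [mul_assoc, e1, add_mul, one_mul, mul_assoc (2 * gammaCoeff K N c N), ← pow_succ] at l'
  rw [mul_assoc, e2, add_mul, one_mul, mul_assoc (2 * gammaCoeff K N c (N - 1)), e3] at r'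
  linarith

lemma HypothesisH.single_term_le {N : ℕ} {c : ℕ → ℝ} (H : HypothesisH N N c) (hN : 2 ≤ N)
    {y : ℝ} (hy : 0 ≤ y) :
    N * gammaCoeff N N c N * y ^ (N - 1) ≤ y + gammaCoeff N N c N * y ^ (N + 1) := by
  have h := H.h2b rfl
  have g0 := gammaCoeff_nonneg N N c N
  set g := gammaCoeff N N c N
  have hNR : (0 : ℝ) ≤ (N : ℝ) - 2 := by
    have : (2 : ℝ) ≤ N := by exact_mod_cast hN
    linarith
  have c2 : ((N - 2 : ℕ) : ℝ) = (N : ℝ) - 2 := by push_cast [hN]; ring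
  have hN0 : (0 : ℝ) < N := by positivity
  have hsq : g ^ 2 * (((N : ℝ) - 2) ^ (N - 2) * 2 ^ 2) ≤ 1 := by
    have hs : (((N : ℝ) - 2) ^ (((N : ℝ) - 2) / 2)) ^ 2 = ((N : ℝ) - 2) ^ (N - 2) := by
      rw [← Real.rpow_natCast, ← Real.rpow_mul hNR, ← Real.rpow_natCast, c2]
      congr 1; push_cast; ring
    -- For `N = 2` base and exponent are both 0, and the power is 1.
    have hpos : 0 < ((N : ℝ) - 2) ^ (((N : ℝ) - 2) / 2) := by
      rcases hNR.eq_or_lt with h0 | h0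
      · rw [← h0]; simp
      · positivity
    rw [le_div_iff₀ (by positivity)] at h
    calc g ^ 2 * (((N : ℝ) - 2) ^ (N - 2) * 2 ^ 2)
        = (g * (2 * ((N : ℝ) - 2) ^ (((N : ℝ) - 2) / 2))) ^ 2 := by rw [← hs]; ring
      _ ≤ 1 := pow_le_one₀ (by positivity) h
  have l := mul_pow_le_one_add_of_pow_le (p := N) (q := N - 2) (d := 2) (by omega)
    (by omega) (A := g) (B := N * g) g0 hy (by
      rw [mul_div_cancel_left₀ _ hN0.ne', c2]
      have : g ^ N = g ^ (N - 2) * g ^ 2 := by rw [← pow_add]; congr 1; omega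
      rw [this, mul_assoc, mul_assoc]
      exact mul_le_of_le_one_right (by positivity) (by simpa using hsq))
  have l' := mul_le_mul_of_nonneg_right l hy
  have e1 : y ^ (N - 2) * y = y ^ (N - 1) := by rw [← pow_succ]; congr 1; omega
  rw [mul_assoc, e1, add_mul, one_mul, mul_assoc g, ← pow_succ] at l'
  exact l'

/-- The differential inequality that makes `exp (-y²/2) (1 + ∑ γ_k y^k)` antitone. -/
lemma HypothesisH.sum_deriv_le {K N : ℕ} {c : ℕ → ℝ} (H : HypothesisH K N c) (hK : 2 ≤ K)
    {y : ℝ} (hy : 0 ≤ y) :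
    ∑ k ∈ Finset.Icc K N, gammaCoeff K N c k * (k * y ^ (k - 1))
      ≤ y * (1 + ∑ k ∈ Finset.Icc K N, gammaCoeff K N c k * y ^ k) := by
  have g0 := gammaCoeff_nonneg K N c
  rcases lt_trichotomy K N with h | h | h
  · have e1 : Finset.Icc K N = insert K (insert (K + 1) (Finset.Icc (K + 2) N)) := by
      ext; simp; omega
    have e2 : Finset.Icc K N = insert N (insert (N - 1) (Finset.Icc K (N - 2))) := by
      ext; simp; omega
    nth_rewrite 1 [e1]
    nth_rewrite 1 [e2]
    rw [Finset.sum_insert (by simp), Finset.sum_insert (by simp), Finset.sum_insert (by simp; omega),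
      Finset.sum_insert (by simp; omega)]
    -- (H1) pairs the derivative term of index `k + 2` with the term of index `k` on the right. The
    -- two lowest terms on the left, and `y` with the two highest terms on the right, remain for
    -- (H2a).
    have hs : ∑ k ∈ Finset.Icc (K + 2) N, gammaCoeff K N c k * (k * y ^ (k - 1))
        ≤ y * ∑ k ∈ Finset.Icc K (N - 2), gammaCoeff K N c k * y ^ k := by
      have e3 : Finset.Icc (K + 2) N = (Finset.Icc K (N - 2)).map (addRightEmbedding 2) := by
        rw [Finset.map_add_right_Icc]; congr 1; omega
      rw [e3, Finset.sum_map, Finset.mul_sum]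
      refine Finset.sum_le_sum fun k hk => ?_
      rw [Finset.mem_Icc] at hk
      have := mul_le_mul_of_nonneg_right (H.h1 k hk.1 (by omega)) (pow_nonneg hy (k + 1))
      simp only [addRightEmbedding_apply, show k + 2 - 1 = k + 1 by omega]
      push_cast
      rw [pow_succ] at this ⊢
      linarith
    have hf := H.first_terms_le hK h hy
    have e4 : y ^ (N - 1) * y = y ^ N := by rw [← pow_succ]; congr 1; omega
    have e5 : K + 1 - 1 = K := by omega
    rw [e5]
    push_cast
    have e6 : y * (gammaCoeff K N c (N - 1) * y ^ (N - 1)) = gammaCoeff K N c (N - 1) * y ^ N := by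
      rw [← e4]; ring
    have e7 : y ^ (N + 1) = y ^ N * y := pow_succ _ _
    simp only [mul_add, e6]
    rw [e7] at hf
    linarith
  · subst h
    have := H.single_term_le hK hy
    simp only [Finset.Icc_self, Finset.sum_singleton]
    rw [pow_succ] at this
    linarith
  · rw [Finset.Icc_eq_empty (by omega)]
    simpa using hy

lemma HypothesisH.antitoneOn {K N : ℕ} {c : ℕ → ℝ} (H : HypothesisH K N c) (hK : 2 ≤ K) :
    AntitoneOn (fun y : ℝ => Real.exp (-y ^ 2 / 2) *
      (1 + ∑ k ∈ Finset.Icc K N, gammaCoeff K N c k * y ^ k)) (Set.Ici 0) := by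
  have hder (y : ℝ) : HasDerivAt (fun y : ℝ => Real.exp (-y ^ 2 / 2) *
      (1 + ∑ k ∈ Finset.Icc K N, gammaCoeff K N c k * y ^ k))
      (Real.exp (-y ^ 2 / 2) * (-y) * (1 + ∑ k ∈ Finset.Icc K N, gammaCoeff K N c k * y ^ k)
        + Real.exp (-y ^ 2 / 2) *
          ∑ k ∈ Finset.Icc K N, gammaCoeff K N c k * (k * y ^ (k - 1))) y := by
    refine HasDerivAt.mul ?_ ?_
    · refine HasDerivAt.exp ?_
      have h : HasDerivAt (fun y : ℝ => -y ^ 2 / 2) (-((2 : ℕ) * y ^ (2 - 1)) / 2) y :=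
        (hasDerivAt_pow 2 y).neg.div_const 2
      exact h.congr_deriv (by push_cast; ring)
    · refine HasDerivAt.const_add _ (HasDerivAt.fun_sum fun k _ => ?_)
      exact (hasDerivAt_pow k y).const_mul _
  refine antitoneOn_of_deriv_nonpos (convex_Ici 0)
    (fun y _ => (hder y).continuousAt.continuousWithinAt)
    (fun y _ => (hder y).differentiableAt.differentiableWithinAt) fun y hy => ?_
  rw [interior_Ici] at hy
  rw [(hder y).deriv]
  have := mul_le_mul_of_nonneg_left (H.sum_deriv_le hK (le_of_lt hy)) (Real.exp_pos (-y ^ 2 / 2)).le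
  linarith

/-! ### Schur's test and the matrix entries -/

/-- Schur's test for lower triangular matrices with the entry `s k j` in column `k`, row `k + j`. -/
lemma sum_sq_antidiagonal_le {s t : ℕ → ℕ → ℝ} {M : ℝ} (hst : ∀ k j, |s k j| ≤ t k j)
    (hrow : ∀ n, ∑ p ∈ Finset.HasAntidiagonal.antidiagonal n, t p.1 p.2 ≤ M)
    (hcol : ∀ k m, ∑ j ∈ Finset.range m, t k j ≤ M) (h : ℕ → ℝ) (m : ℕ) :
    ∑ n ∈ Finset.range m, (∑ p ∈ Finset.HasAntidiagonal.antidiagonal n, s p.1 p.2 * h p.1) ^ 2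
      ≤ M ^ 2 * ∑ k ∈ Finset.range m, h k ^ 2 := by
  have ht0 (k j : ℕ) : 0 ≤ t k j := (abs_nonneg _).trans (hst k j)
  have hM : 0 ≤ M := by simpa using hcol 0 0
  have h1 (n : ℕ) : (∑ p ∈ Finset.HasAntidiagonal.antidiagonal n, s p.1 p.2 * h p.1) ^ 2
      ≤ M * ∑ p ∈ Finset.HasAntidiagonal.antidiagonal n, t p.1 p.2 * h p.1 ^ 2 := by
    -- Cauchy–Schwarz with `t` split as `√t · √t`: one factor gives the row sum, the other is later
    -- summed along columns.
    have hcs := Finset.sum_mul_sq_le_sq_mul_sq (Finset.HasAntidiagonal.antidiagonal n)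
      (fun p => √(t p.1 p.2)) (fun p => √(t p.1 p.2) * |h p.1|)
    simp only [← mul_assoc, mul_pow, Real.mul_self_sqrt (ht0 _ _), Real.sq_sqrt (ht0 _ _),
      sq_abs] at hcs
    refine le_trans (le_trans ?_ hcs)
      (mul_le_mul_of_nonneg_right (hrow n) (Finset.sum_nonneg fun p _ =>
        mul_nonneg (ht0 _ _) (sq_nonneg _)))
    refine sq_le_sq.2 (le_trans (Finset.abs_sum_le_sum_abs _ _) (le_trans ?_ (le_abs_self _)))
    refine Finset.sum_le_sum fun p _ => ?_
    rw [abs_mul]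
    exact mul_le_mul_of_nonneg_right (hst _ _) (abs_nonneg _)
  calc _ ≤ ∑ n ∈ Finset.range m,
        M * ∑ p ∈ Finset.HasAntidiagonal.antidiagonal n, t p.1 p.2 * h p.1 ^ 2 :=
        Finset.sum_le_sum fun n _ => h1 n
    _ = M * ∑ k ∈ Finset.range m, h k ^ 2 * ∑ j ∈ Finset.range (m - k), t k j := by
        rw [← Finset.mul_sum]
        congr 1
        simp_rw [Finset.Nat.sum_antidiagonal_eq_sum_range_succ (fun k j => t k j * h k ^ 2)]
        rw [Finset.sum_range_diag_flip m (fun k j => t k j * h k ^ 2)]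
        simp_rw [Finset.mul_sum, mul_comm]
    _ ≤ M * ∑ k ∈ Finset.range m, h k ^ 2 * M := by
        gcongr with k _
        exact hcol _ _
    _ = _ := by rw [← Finset.sum_mul]; ring

/-- The absolute value of the matrix entry in column `k`, row `k + j`, of the map that sends the
Hermite coefficients of order at least `K` of `f` to those of `af * bφ`. -/
noncomputable def entry (K : ℕ) (a b : ℝ) (c : ℕ → ℝ) (k j : ℕ) : ℝ :=
  if K ≤ k then √((k + j).choose k : ℝ) * a ^ k * b ^ j * c j else 0

lemma gammaCoeff_eq (K N : ℕ) (c : ℕ → ℝ) (k : ℕ) :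
    gammaCoeff K N c k = √(1 + (N : ℝ) / K) ^ k * |c k| / √(k.factorial : ℝ) := by
  rw [gammaCoeff, Real.rpow_div_two_eq_sqrt _ (by positivity), Real.rpow_natCast]

lemma one_sub_sq_le_neg_two_mul_log {a : ℝ} (ha : 0 < a) : 1 - a ^ 2 ≤ -2 * Real.log a := by
  have := Real.log_le_sub_one_of_pos (show 0 < a ^ 2 by positivity)
  rw [Real.log_pow] at this
  push_cast at this
  linarith

/-- From `n choose j ≤ n^j / j!`. The factor `w` is meant to be `1 + N/K`, absorbed by `γ_j`, and
`z` the squared variable `y²`. -/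
lemma sqrt_choose_mul_le {n j : ℕ} {b z w : ℝ} (hb : 0 ≤ b) (hw : 0 ≤ w)
    (h : n * b ^ 2 ≤ w * z) :
    √(n.choose j : ℝ) * b ^ j ≤ √w ^ j * √z ^ j / √(j.factorial : ℝ) := by
  rw [← mul_pow, ← Real.sqrt_mul hw]
  refine (le_div_iff₀ (by positivity)).2 ?_
  have h1 : (n.choose j : ℝ) * j.factorial ≤ n ^ j := by
    rw [← le_div_iff₀ (by positivity)]; exact Nat.choose_le_pow_div j n
  have e : √(n.choose j : ℝ) * b ^ j * √(j.factorial : ℝ)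
      = √((n.choose j : ℝ) * j.factorial) * b ^ j := by
    rw [Real.sqrt_mul (by positivity)]; ring
  rw [e]
  calc _ ≤ √((n : ℝ) ^ j) * b ^ j := by gcongr
    _ = (√(n : ℝ) * b) ^ j := by
      rw [mul_pow]; congr 1
      rw [Real.sqrt_eq_iff_mul_self_eq (by positivity) (by positivity), ← mul_pow,
        Real.mul_self_sqrt (by positivity)]
    _ = √(n * b ^ 2) ^ j := by rw [Real.sqrt_mul (by positivity), Real.sqrt_sq hb]
    _ ≤ _ := by gcongr

section entries

variable {K N : ℕ} {a : ℝ} {c : ℕ → ℝ}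

/-- Along column `k`, `k + j ≤ (1 + N/K) k` because `j ≤ N` and `K ≤ k`; this is the origin of the
factor in `γ_j`. -/
lemma entry_abs_le_column (hK : 1 ≤ K) (ha : 0 < a) (ha1 : a < 1) {k j : ℕ} (hk : K ≤ k)
    (hj : j ≤ N) :
    |entry K a √(1 - a ^ 2) c k j|
      ≤ a ^ k * (gammaCoeff K N c j * √(-2 * Real.log a * k) ^ j) := by
  have hb : 0 ≤ 1 - a ^ 2 := by nlinarith
  have hL : 0 ≤ -2 * Real.log a := hb.trans (one_sub_sq_le_neg_two_mul_log ha)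
  have hKR : (0 : ℝ) < K := by exact_mod_cast hK
  have hkn : ((k + j : ℕ) : ℝ) ≤ (1 + (N : ℝ) / K) * k := by
    have h1 : (j : ℝ) ≤ N := by exact_mod_cast hj
    have h2 : (K : ℝ) ≤ k := by exact_mod_cast hk
    have h3 : (N : ℝ) ≤ N / K * k := by
      rw [div_mul_eq_mul_div, le_div_iff₀ hKR]; gcongr
    push_cast
    linarith
  have key := sqrt_choose_mul_le (n := k + j) (j := j) (b := √(1 - a ^ 2))
    (w := 1 + (N : ℝ) / K) (z := -2 * Real.log a * k) (by positivity) (by positivity) (by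
      rw [Real.sq_sqrt hb]
      calc _ ≤ (1 + (N : ℝ) / K) * k * (-2 * Real.log a) :=
            mul_le_mul hkn (one_sub_sq_le_neg_two_mul_log ha) hb (by positivity)
        _ = _ := by ring)
  rw [← Nat.choose_symm_add] at key
  rw [entry, if_pos hk, gammaCoeff_eq, abs_mul, abs_of_nonneg (by positivity)]
  calc _ = a ^ k * |c j| * (√((k + j).choose k : ℝ) * √(1 - a ^ 2) ^ j) := by ring
    _ ≤ a ^ k * |c j| * _ := mul_le_mul_of_nonneg_left key (by positivity)
    _ = _ := by ring

/-- Along a row the prefactor must be `a^(k+j)`, so `b` is replaced by `b/a`; the lost `a²` is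
repaid by the factor `1 + N/K`, which needs `a` close enough to 1. -/
lemma entry_abs_le_row (ha : 0 < a) (ha1 : a < 1) (haC : 1 ≤ (1 + (N : ℝ) / K) * a ^ 2)
    {k j : ℕ} (hk : K ≤ k) :
    |entry K a √(1 - a ^ 2) c k j|
      ≤ a ^ (k + j) * (gammaCoeff K N c j * √(-2 * Real.log a * (k + j : ℕ)) ^ j) := by
  have hb : 0 ≤ 1 - a ^ 2 := by nlinarith
  have hL : 0 ≤ -2 * Real.log a := hb.trans (one_sub_sq_le_neg_two_mul_log ha)
  have key := sqrt_choose_mul_le (n := k + j) (j := j) (b := √(1 - a ^ 2) / a)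
    (w := 1 + (N : ℝ) / K) (z := -2 * Real.log a * (k + j : ℕ)) (by positivity) (by positivity) (by
      rw [div_pow, Real.sq_sqrt hb, mul_div_assoc', div_le_iff₀ (by positivity)]
      calc _ ≤ ((k + j : ℕ) : ℝ) * (-2 * Real.log a) * ((1 + (N : ℝ) / K) * a ^ 2) := by
            refine le_trans ?_ (le_mul_of_one_le_right (by positivity) haC)
            gcongr
            exact one_sub_sq_le_neg_two_mul_log ha
        _ = _ := by ring)
  rw [← Nat.choose_symm_add] at key
  rw [entry, if_pos hk, gammaCoeff_eq, abs_mul, abs_of_nonneg (by positivity)]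
  calc _ = a ^ (k + j) * |c j| * (√((k + j).choose k : ℝ) * (√(1 - a ^ 2) / a) ^ j) := by
        rw [pow_add, div_pow]; field_simp
    _ ≤ a ^ (k + j) * |c j| * _ := mul_le_mul_of_nonneg_left key (by positivity)
    _ = _ := by ring

lemma sum_gammaCoeff_le (hc0 : c 0 = 1) (hc : ∀ k, 1 ≤ k → k < K ∨ N < k → c k = 0)
    (s : Finset ℕ) {y : ℝ} (hy : 0 ≤ y) :
    ∑ j ∈ s, gammaCoeff K N c j * y ^ j
      ≤ 1 + ∑ k ∈ Finset.Icc K N, gammaCoeff K N c k * y ^ k := by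
  have h0 : gammaCoeff K N c 0 * y ^ 0 = 1 := by simp [gammaCoeff, hc0]
  have hnn (k : ℕ) : 0 ≤ gammaCoeff K N c k * y ^ k :=
    mul_nonneg (gammaCoeff_nonneg _ _ _ _) (pow_nonneg hy _)
  have h1 : ∑ j ∈ s, gammaCoeff K N c j * y ^ j
      ≤ ∑ k ∈ insert 0 (Finset.Icc K N), gammaCoeff K N c k * y ^ k := by
    rw [← Finset.sum_filter_of_ne (p := fun j => j ∈ insert 0 (Finset.Icc K N))]
    · exact Finset.sum_le_sum_of_subset_of_nonneg (fun j => by simp) fun k _ _ => hnn k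
    · intro j _ hj
      by_contra hj'
      simp only [Finset.mem_insert, Finset.mem_Icc] at hj'
      exact hj (by simp [gammaCoeff, hc j (by omega) (by omega)])
  refine h1.trans ?_
  by_cases hK : 0 ∈ Finset.Icc K N
  · rw [Finset.insert_eq_of_mem hK]; linarith
  · rw [Finset.sum_insert hK, h0]

lemma pow_mul_le_of_hypothesisH (H : HypothesisH K N c) (hK : 2 ≤ K) (ha : 0 < a) (ha1 : a < 1)
    {m : ℕ} (hm : K ≤ m) :
    a ^ m * (1 + ∑ k ∈ Finset.Icc K N, gammaCoeff K N c k * √(-2 * Real.log a * m) ^ k)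
      ≤ a ^ K * (1 + ∑ k ∈ Finset.Icc K N, gammaCoeff K N c k * √(-2 * Real.log a * K) ^ k) := by
  have hL : 0 ≤ -2 * Real.log a := by linarith [Real.log_neg ha ha1]
  have e (n : ℕ) : Real.exp (-√(-2 * Real.log a * n) ^ 2 / 2) = a ^ n := by
    rw [Real.sq_sqrt (by positivity), ← Real.exp_log (pow_pos ha n), Real.log_pow]
    congr 1; ring
  have := H.antitoneOn hK (a := √(-2 * Real.log a * K)) (b := √(-2 * Real.log a * m))
    (Real.sqrt_nonneg _) (Real.sqrt_nonneg _) (by gcongr)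
  simpa only [e] using this

end entries

/-- There is slack here: `d_φ` carries `r + 1 + N` where the value at `m = K` has only `r + 1`. -/
lemma sum_gammaCoeff_le_dFun {r N : ℕ} {c : ℕ → ℝ} {a : ℝ} (ha : 0 < a) (ha1 : a < 1) :
    ∑ k ∈ Finset.Icc (r + 1) N, gammaCoeff (r + 1) N c k * √(-2 * Real.log a * (r + 1 : ℕ)) ^ k
      ≤ dFun r N c a := by
  have hL : 0 ≤ -2 * Real.log a := by linarith [Real.log_neg ha ha1]
  refine Finset.sum_le_sum fun k _ => ?_
  have hC : (0 : ℝ) ≤ 1 + (N : ℝ) / ((r : ℝ) + 1) := by positivity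
  have e : -2 * ((r : ℝ) + 1 + N) * (1 + (N : ℝ) / ((r : ℝ) + 1)) * Real.log a
      = (1 + (N : ℝ) / ((r : ℝ) + 1)) * (-2 * Real.log a * ((r : ℝ) + 1 + N)) := by ring
  rw [e, gammaCoeff_eq, Real.rpow_div_two_eq_sqrt _ (by positivity), Real.rpow_natCast,
    Real.sqrt_mul hC, mul_pow]
  push_cast
  calc _ = |c k| / √(k.factorial : ℝ) * (√(1 + (N : ℝ) / ((r : ℝ) + 1)) ^ k *
        √(-2 * Real.log a * ((r : ℝ) + 1)) ^ k) := by ring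
    _ ≤ _ := by
      have : (r : ℝ) + 1 ≤ (r : ℝ) + 1 + N := le_add_of_nonneg_right (Nat.cast_nonneg N)
      gcongr

/-- The norm bound for the map on Hermite coefficients. -/
lemma sum_sq_entry_le {r N : ℕ} {c : ℕ → ℝ} {a : ℝ} (hr : 1 ≤ r)
    (H : HypothesisH (r + 1) N c) (ha : aThreshold r N < a) (ha1 : a < 1)
    (hc0 : c 0 = 1) (hc : ∀ k, 1 ≤ k → k < r + 1 ∨ N < k → c k = 0) (h : ℕ → ℝ) (m : ℕ) :
    ∑ n ∈ Finset.range m, (∑ p ∈ Finset.HasAntidiagonal.antidiagonal n,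
        entry (r + 1) a √(1 - a ^ 2) c p.1 p.2 * h p.1) ^ 2
      ≤ (a ^ (r + 1) * (1 + dFun r N c a)) ^ 2 * ∑ k ∈ Finset.range m, h k ^ 2 := by
  have hC : (0 : ℝ) < 1 + (N : ℝ) / ((r : ℝ) + 1) := by positivity
  have hap : 0 < aThreshold r N := by unfold aThreshold; positivity
  have ha0 : 0 < a := hap.trans ha
  have haC : 1 ≤ (1 + (N : ℝ) / (r + 1 : ℕ)) * a ^ 2 := by
    have h4 : aThreshold r N ^ 4 = (1 + (N : ℝ) / ((r : ℝ) + 1))⁻¹ := by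
      rw [aThreshold, ← Real.rpow_natCast, ← Real.rpow_mul hC.le, ← Real.rpow_neg_one]
      norm_num
    have h5 : (1 + (N : ℝ) / ((r : ℝ) + 1))⁻¹ ≤ a ^ 4 := by
      rw [← h4]; gcongr
    -- The threshold controls `a^4`, whereas the row estimate needs only the weaker bound on `a²`.
    have h6 : a ^ 4 ≤ a ^ 2 := pow_le_pow_of_le_one ha0.le ha1.le (by norm_num)
    have h7 := h5.trans h6
    rw [inv_le_iff_one_le_mul₀' hC] at h7
    push_cast
    exact h7
  set M := a ^ (r + 1) * (1 + dFun r N c a)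
  have hM {n : ℕ} (hn : r + 1 ≤ n) : a ^ n * (1 + ∑ k ∈ Finset.Icc (r + 1) N,
      gammaCoeff (r + 1) N c k * √(-2 * Real.log a * n) ^ k) ≤ M :=
    (pow_mul_le_of_hypothesisH H (by omega) ha0 ha1 hn).trans
      (mul_le_mul_of_nonneg_left (add_le_add_right (sum_gammaCoeff_le_dFun ha0 ha1) 1)
        (by positivity))
  have hM0 : 0 ≤ M := le_trans (by
    refine mul_nonneg (by positivity) (add_nonneg zero_le_one (Finset.sum_nonneg fun k _ => ?_))
    exact mul_nonneg (gammaCoeff_nonneg _ _ _ _) (by positivity)) (hM le_rfl)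
  have hzero {k j : ℕ} (hk : ¬ r + 1 ≤ k) : entry (r + 1) a √(1 - a ^ 2) c k j = 0 := if_neg hk
  have hzero' {k j : ℕ} (hj : N < j) : entry (r + 1) a √(1 - a ^ 2) c k j = 0 := by
    rcases Nat.eq_zero_or_pos j with rfl | h0
    · omega
    · simp [entry, hc j h0 (Or.inr hj)]
  refine sum_sq_antidiagonal_le (fun _ _ => le_rfl) (fun n => ?_) (fun k m => ?_) h m
  · by_cases hn : r + 1 ≤ n
    · refine le_trans ?_ (hM hn)
      rw [← Finset.Nat.sum_antidiagonal_swap, Finset.Nat.sum_antidiagonal_eq_sum_range_succ_mk]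
      refine le_trans ?_ (mul_le_mul_of_nonneg_left (sum_gammaCoeff_le hc0 hc
        (Finset.range (n + 1)) (Real.sqrt_nonneg (-2 * Real.log a * n))) (by positivity))
      rw [Finset.mul_sum]
      refine Finset.sum_le_sum fun j hj => ?_
      simp only [Prod.fst_swap, Prod.snd_swap]
      by_cases hk : r + 1 ≤ n - j
      · have := entry_abs_le_row (c := c) ha0 ha1 haC (j := j) hk
        rwa [Nat.sub_add_cancel (by rw [Finset.mem_range] at hj; omega)] at this
      · rw [hzero hk, abs_zero]
        have := gammaCoeff_nonneg (r + 1) N c j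
        positivity
    · refine le_trans (le_of_eq (Finset.sum_eq_zero fun p hp => ?_)) hM0
      rw [Finset.HasAntidiagonal.mem_antidiagonal] at hp
      rw [hzero (by omega), abs_zero]
  · by_cases hk : r + 1 ≤ k
    · refine le_trans ?_ (hM hk)
      refine le_trans ?_ (mul_le_mul_of_nonneg_left (sum_gammaCoeff_le hc0 hc
        (Finset.range m) (Real.sqrt_nonneg (-2 * Real.log a * k))) (by positivity))
      rw [Finset.mul_sum]
      refine Finset.sum_le_sum fun j _ => ?_
      by_cases hj : j ≤ N
      · exact entry_abs_le_column (by omega) ha0 ha1 hk hj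
      · rw [hzero' (by omega), abs_zero]
        have := gammaCoeff_nonneg (r + 1) N c j
        positivity
    · refine le_trans (le_of_eq (Finset.sum_eq_zero fun j _ => ?_)) hM0
      rw [hzero hk, abs_zero]

/-! ### Behaviour of `d_φ` near 1 -/

lemma tendsto_dFun (r N : ℕ) (c : ℕ → ℝ) : ∃ L : ℝ, Tendsto
    (fun a : ℝ => |Real.log a| ^ (-(((r : ℝ) + 1) / 2)) * dFun r N c a)
    (𝓝[<] (1 : ℝ)) (𝓝 L) := by
  set C : ℝ := 2 * ((r : ℝ) + 1 + N) * (1 + (N : ℝ) / ((r : ℝ) + 1))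
  have hC : 0 ≤ C := by positivity
  have hlog : Tendsto (fun a : ℝ => -Real.log a) (𝓝[<] 1) (𝓝 0) := by
    have := (Real.continuousAt_log one_ne_zero).neg.tendsto
    rw [Pi.neg_apply, Real.log_one, neg_zero] at this
    exact this.mono_left nhdsWithin_le_nhds
  -- After division the exponents `(k - (r+1))/2` are nonnegative; in the limit only `k = r + 1` can
  -- survive, through `0^0 = 1`.
  have key : Tendsto (fun a : ℝ => ∑ k ∈ Finset.Icc (r + 1) N, |c k| / √(k.factorial : ℝ)
      * (C ^ ((k : ℝ) / 2) * (-Real.log a) ^ (((k : ℝ) - (r + 1)) / 2))) (𝓝[<] 1)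
      (𝓝 (∑ k ∈ Finset.Icc (r + 1) N, |c k| / √(k.factorial : ℝ)
      * (C ^ ((k : ℝ) / 2) * (0 : ℝ) ^ (((k : ℝ) - (r + 1)) / 2)))) := by
    refine tendsto_finsetSum _ fun k hk => (Tendsto.const_mul _ ?_).const_mul _
    refine hlog.rpow_const (Or.inr ?_)
    rw [Finset.mem_Icc] at hk
    have : ((r : ℝ) + 1) ≤ k := by exact_mod_cast hk.1
    linarith
  refine ⟨_, key.congr' ?_⟩
  filter_upwards [Ioo_mem_nhdsLT (show (0 : ℝ) < 1 by norm_num)] with a ha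
  have hl : 0 < -Real.log a := by linarith [Real.log_neg ha.1 ha.2]
  rw [dFun, Finset.mul_sum]
  refine Finset.sum_congr rfl fun k _ => ?_
  have e : -2 * ((r : ℝ) + 1 + N) * (1 + (N : ℝ) / ((r : ℝ) + 1)) * Real.log a
      = C * (-Real.log a) := by ring
  have e2 : ((k : ℝ) - (r + 1)) / 2 = -(((r : ℝ) + 1) / 2) + (k : ℝ) / 2 := by ring
  rw [e, Real.mul_rpow hC hl.le, abs_of_neg (neg_pos.1 hl), e2, Real.rpow_add hl]
  ring

/-! ### Densities and the `χ₂`-distance -/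

section density

variable {f h : ℝ → ℝ}

lemma isFiniteMeasure_withDens (hf : MemLp f 2 stdNormal) : IsFiniteMeasure (withDens f) :=
  isFiniteMeasure_withDensity_ofReal (hf.integrable (by norm_num)).2

lemma integral_withDens (hf : AEMeasurable f stdNormal) (h : ℝ → ℝ) :
    ∫ x, h x ∂withDens f = ∫ x, max (f x) 0 * h x ∂stdNormal := by
  rw [withDens, integral_withDensity_eq_integral_toReal_smul₀ hf.ennreal_ofReal (by simp)]
  simp [ENNReal.toReal_ofReal']

lemma memLp_max_zero (hf : MemLp f 2 stdNormal) :
    MemLp (fun x => max (f x) 0) 2 stdNormal := hf.pos_part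

lemma integrable_withDens (hf : MemLp f 2 stdNormal) (hh : MemLp h 2 stdNormal) :
    Integrable h (withDens f) := by
  rw [withDens, integrable_withDensity_iff_integrable_smul₀' hf.aemeasurable.ennreal_ofReal
    (by simp)]
  simpa [ENNReal.toReal_ofReal'] using! (memLp_max_zero hf).integrable_mul hh

lemma IsL2Density.integral_withDens (hf : IsL2Density f) (h : ℝ → ℝ) :
    ∫ x, h x ∂withDens f = ∫ x, f x * h x ∂stdNormal := by
  rw [_root_.integral_withDens hf.memLp.aemeasurable]
  refine integral_congr_ae ?_
  filter_upwards [hf.nonneg] with x hx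
  rw [max_eq_left hx]

lemma memLp_exp_mul (t : ℝ) : MemLp (fun x : ℝ => Real.exp (t * x)) 2 stdNormal := by
  rw [memLp_two_iff_integrable_sq (by fun_prop)]
  have : ∀ x : ℝ, Real.exp (t * x) ^ 2 = Real.exp ((2 * t) * x) := fun x => by
    rw [← Real.exp_nat_mul]; congr 1; push_cast; ring
  simp_rw [this]
  exact integrable_exp_mul_gaussianReal _

lemma chi2Dist_withDens (hf : MemLp f 2 stdNormal) (h0 : ∀ᵐ x ∂stdNormal, 0 ≤ f x) :
    chi2Dist (withDens f) stdNormal = eLpNorm (fun x => f x - 1) 2 stdNormal := by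
  have hac : withDens f ≪ stdNormal := withDensity_absolutelyContinuous _ _
  rw [chi2Dist, if_pos hac, eLpNorm_eq_lintegral_rpow_enorm_toReal (by norm_num) (by norm_num)]
  congr 1
  · refine lintegral_congr_ae ?_
    filter_upwards [Measure.rnDeriv_withDensity₀ stdNormal hf.aemeasurable.ennreal_ofReal, h0]
      with x hx hx0
    rw [withDens, hx, ENNReal.toReal_ofReal hx0, Real.enorm_eq_ofReal_abs,
      ENNReal.ofReal_rpow_of_nonneg (abs_nonneg _) (by norm_num)]
    simp

end density

/-! ### Hermite expansions in `L²` and identification of densities -/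

/-- The normalized Hermite polynomials as elements of `L²(μ)`. -/
noncomputable def hermiteL2 (n : ℕ) : Lp ℝ 2 stdNormal := (memLp_normHermite n).toLp _

lemma inner_hermiteL2_toLp {f : ℝ → ℝ} (hf : MemLp f 2 stdNormal) (n : ℕ) :
    inner ℝ (hermiteL2 n) (hf.toLp f) = hermiteCoeff f n := by
  rw [L2.inner_def, hermiteCoeff]
  refine integral_congr_ae ?_
  filter_upwards [(memLp_normHermite n).coeFn_toLp, hf.coeFn_toLp] with x h1 h2
  rw [hermiteL2, h1, h2]
  simp

lemma orthonormal_hermiteL2 : Orthonormal ℝ hermiteL2 := by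
  rw [orthonormal_iff_ite]
  intro i j
  rw [hermiteL2.eq_1 j, inner_hermiteL2_toLp, hermiteCoeff, integral_normHermite_mul_normHermite]
  simp [eq_comm]

/-- Riesz–Fischer for the Hermite system. -/
lemma exists_inner_hermiteL2_eq {w : ℕ → ℝ} {C : ℝ} (hC : 0 ≤ C)
    (hw : ∀ m, ∑ n ∈ Finset.range m, w n ^ 2 ≤ C ^ 2) :
    ∃ W : Lp ℝ 2 stdNormal, (∀ n, inner ℝ (hermiteL2 n) W = w n) ∧ ‖W‖ ≤ C := by
  have hw' (s : Finset ℕ) : ∑ n ∈ s, ‖w n‖ ^ (2 : ℝ≥0∞).toReal ≤ C ^ (2 : ℝ≥0∞).toReal := by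
    simp only [ENNReal.toReal_ofNat, Real.rpow_two, Real.norm_eq_abs, sq_abs]
    refine le_trans ?_ (hw (s.sup id + 1))
    refine Finset.sum_le_sum_of_subset_of_nonneg (fun n hn => ?_) fun _ _ _ => sq_nonneg _
    exact Finset.mem_range.2 (Nat.lt_succ_of_le (Finset.le_sup (f := id) hn))
  let W : lp (fun _ : ℕ => ℝ) 2 := ⟨w, memℓp_gen' hw'⟩
  refine ⟨orthonormal_hermiteL2.orthogonalFamily.linearIsometry W, fun n => ?_, ?_⟩
  · have h := (orthonormal_hermiteL2.orthogonalFamily.hasSum_linearIsometry W).mapL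
      (innerSL ℝ (hermiteL2 n))
    refine h.unique ?_
    convert! hasSum_ite_eq n (w n) using 2 with i
    have := orthonormal_iff_ite.1 orthonormal_hermiteL2 n i
    rw [LinearIsometry.toSpanSingleton_apply, innerSL_apply_apply, inner_smul_right, this]
    by_cases hi : n = i
    · subst hi; simp [W]
    · simp [W, hi, Ne.symm hi]
  · rw [LinearIsometry.norm_map]
    exact lp.norm_le_of_forall_sum_le (by simp) hC hw'

/-- Bessel's inequality for `f - 1`, whose coefficients of positive order are those of `f`. -/
lemma sum_sq_hermiteCoeff_le {f : ℝ → ℝ} (hf : MemLp f 2 stdNormal) {s : Finset ℕ} (hs : 0 ∉ s) :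
    ∑ k ∈ s, hermiteCoeff f k ^ 2 ≤ ‖hf.toLp f - hermiteL2 0‖ ^ 2 := by
  have h := orthonormal_hermiteL2.sum_inner_products_le (hf.toLp f - hermiteL2 0) (s := s)
  refine le_trans (Finset.sum_le_sum fun k hk => ?_) h
  have hk0 : k ≠ 0 := fun h => hs (h ▸ hk)
  rw [inner_sub_right, inner_hermiteL2_toLp, orthonormal_iff_ite.1 orthonormal_hermiteL2 k 0,
    if_neg hk0, sub_zero, Real.norm_eq_abs, sq_abs]

lemma eLpNorm_sub_one (G : Lp ℝ 2 stdNormal) :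
    eLpNorm (fun x => G x - 1) 2 stdNormal = ENNReal.ofReal ‖G - hermiteL2 0‖ := by
  rw [ofReal_norm, Lp.enorm_def]
  refine eLpNorm_congr_ae ?_
  filter_upwards [Lp.coeFn_sub G (hermiteL2 0), (memLp_normHermite 0).coeFn_toLp] with x h1 h2
  rw [h1, Pi.sub_apply, hermiteL2, h2, normHermite_zero]

lemma IsL2Density.chi2_eq {f : ℝ → ℝ} (hf : IsL2Density f) :
    chi2 f = ENNReal.ofReal ‖hf.memLp.toLp f - hermiteL2 0‖ := by
  rw [chi2, chi2Dist_withDens hf.memLp hf.nonneg, ← eLpNorm_sub_one]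
  refine eLpNorm_congr_ae ?_
  filter_upwards [hf.memLp.coeFn_toLp] with x hx
  rw [hx]

/-- A finite measure with all exponential moments whose Hermite moments are the Hermite
coefficients of `G ∈ L²(μ)` has the density `G`. -/
lemma eq_withDens_of_hermite_moments {θ : Measure ℝ} [IsFiniteMeasure θ]
    (hθ : ∀ t : ℝ, Integrable (fun x => Real.exp (t * x)) θ) (G : Lp ℝ 2 stdNormal)
    (hG : ∀ n, ∫ x, normHermite n x ∂θ = inner ℝ (hermiteL2 n) G) :
    θ = withDens G ∧ ∀ᵐ x ∂stdNormal, 0 ≤ G x := by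
  have hGm : MemLp G 2 stdNormal := Lp.memLp G
  have hNm : MemLp (fun x => -G x) 2 stdNormal := hGm.neg
  have hcoeff (n : ℕ) : inner ℝ (hermiteL2 n) G = ∫ x, G x * normHermite n x ∂stdNormal := by
    rw [← hermiteCoeff, ← inner_hermiteL2_toLp hGm, Lp.toLp_coeFn]
  have hpow (n : ℕ) : Integrable (fun x => x ^ n) θ := by
    have : (0 : ℝ) ∈ interior (integrableExpSet id θ) := by
      rw [show integrableExpSet id θ = Set.univ from Set.eq_univ_of_forall hθ]; simp
    exact integrable_pow_of_mem_interior_integrableExpSet this n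
  have hpoly (P : Polynomial ℝ) : Integrable (fun x => P.eval x) θ := by
    simp_rw [Polynomial.eval_eq_sum_range]
    exact integrable_finsetSum _ fun i _ => (hpow i).const_mul _
  have hmom (n : ℕ) : ∫ x, x ^ n ∂θ = ∫ x, G x * x ^ n ∂stdNormal := by
    obtain ⟨c, hc⟩ := exists_eq_sum_normHermite (Polynomial.X ^ n)
    simp only [Polynomial.eval_pow, Polynomial.eval_X] at hc
    simp_rw [hc, Finset.mul_sum]
    rw [integral_finsetSum, integral_finsetSum]
    · refine Finset.sum_congr rfl fun k _ => ?_
      simp_rw [mul_left_comm (G _), integral_const_mul, hG, hcoeff]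
    · intro k _
      simp_rw [mul_left_comm (G _)]
      exact (integrable_mul_normHermite hGm k).const_mul _
    · intro k _
      refine Integrable.const_mul ?_ _
      rw [funext (normHermite_eq k)]
      exact hpoly _
  have fG := isFiniteMeasure_withDens hGm
  have fN := isFiniteMeasure_withDens hNm
  have hpowm (n : ℕ) : MemLp (fun x : ℝ => x ^ n) 2 stdNormal := memLp_pow_stdNormal n (by simp)
  -- The sign of `G` is not yet known and `withDens` truncates at 0. Moving the negative part to the
  -- other side leaves two positive measures with equal moments.
  have hsum : θ + withDens (fun x => -G x) = withDens G := by
    refine ext_of_forall_integral_pow_eq (fun t => ?_) (fun t => ?_) fun n => ?_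
    · exact (hθ t).add_measure (integrable_withDens hNm (memLp_exp_mul t))
    · exact integrable_withDens hGm (memLp_exp_mul t)
    · rw [integral_add_measure (hpow n) (integrable_withDens hNm (hpowm n)), hmom,
        integral_withDens hNm.aemeasurable, integral_withDens hGm.aemeasurable,
        ← integral_add (f := fun x => G x * x ^ n) (g := fun x => max (-G x) 0 * x ^ n)
          (hGm.integrable_mul (hpowm n)) ((memLp_max_zero hNm).integrable_mul (hpowm n))]
      refine integral_congr_ae (Eventually.of_forall fun x => ?_)
      dsimp only
      rcases le_total 0 (G x) with h | h
      · rw [max_eq_right (neg_nonpos.2 h), max_eq_left h]; ring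
      · rw [max_eq_left (neg_nonneg.2 h), max_eq_right h]; ring
  have hsm : MeasurableSet {x | G x < 0} :=
    measurableSet_lt (Lp.stronglyMeasurable G).measurable measurable_const
  -- The positive part does not charge `{G < 0}`, so by `hsum` neither does the negative part, which
  -- lives there.
  have hneg : withDens (fun x => -G x) {x | G x < 0} = 0 := by
    have h1 : withDens G {x | G x < 0} = 0 := by
      rw [withDens, withDensity_apply _ hsm, setLIntegral_eq_zero_iff hsm
        (Lp.stronglyMeasurable G).measurable.ennreal_ofReal]
      exact Eventually.of_forall fun x hx => ENNReal.ofReal_of_nonpos (le_of_lt hx)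
    rw [← hsum, Measure.add_apply] at h1
    exact (add_eq_zero.1 h1).2
  have hpos : ∀ᵐ x ∂stdNormal, 0 ≤ G x := by
    rw [withDens, withDensity_apply _ hsm, setLIntegral_eq_zero_iff hsm
      (Lp.stronglyMeasurable G).measurable.fun_neg.ennreal_ofReal] at hneg
    filter_upwards [hneg] with x hx
    by_contra hlt
    rw [not_le] at hlt
    have := hx hlt
    rw [ENNReal.ofReal_eq_zero] at this
    linarith
  refine ⟨?_, hpos⟩
  have hz : withDens (fun x => -G x) = 0 := by
    rw [withDens, withDensity_eq_zero_iff hNm.aemeasurable.ennreal_ofReal]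
    filter_upwards [hpos] with x hx
    simpa using hx
  rw [← hsum, hz, add_zero]

/-! ### The law of `aU + bV` -/

section convolution

variable {a b : ℝ} {f φ : ℝ → ℝ}

lemma integrable_exp_convLaw (hf : MemLp f 2 stdNormal) (hφ : MemLp φ 2 stdNormal) (t : ℝ) :
    Integrable (fun x => Real.exp (t * x)) (convLaw a b f φ) := by
  have := isFiniteMeasure_withDens hf
  have := isFiniteMeasure_withDens hφ
  rw [convLaw, integrable_map_measure (by fun_prop) (by fun_prop)]
  have h := (integrable_withDens hf (memLp_exp_mul (t * a))).mul_prod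
    (integrable_withDens hφ (memLp_exp_mul (t * b)))
  refine h.congr (Eventually.of_forall fun p => ?_)
  simp only [Function.comp_apply]
  rw [← Real.exp_add]; congr 1; ring

lemma integral_normHermite_convLaw (hab : a ^ 2 + b ^ 2 = 1) (hf : IsL2Density f)
    (hφ : IsL2Density φ) (n : ℕ) :
    ∫ x, normHermite n x ∂convLaw a b f φ = ∑ p ∈ Finset.HasAntidiagonal.antidiagonal n,
      √((p.1 + p.2).choose p.1 : ℝ) * a ^ p.1 * b ^ p.2
        * (hermiteCoeff f p.1 * hermiteCoeff φ p.2) := by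
  have := isFiniteMeasure_withDens hf.memLp
  have := isFiniteMeasure_withDens hφ.memLp
  have hmeas : Measurable (normHermite n) := by
    rw [funext (normHermite_eq n)]; exact (Polynomial.continuous _).measurable
  rw [convLaw, integral_map (by fun_prop) hmeas.aestronglyMeasurable]
  simp_rw [normHermite_add hab]
  rw [integral_finsetSum]
  · refine Finset.sum_congr rfl fun p _ => ?_
    rw [integral_const_mul, integral_prod_mul, hf.integral_withDens, hφ.integral_withDens,
      hermiteCoeff, hermiteCoeff]
  · intro p _
    exact ((integrable_withDens hf.memLp (memLp_normHermite _)).mul_prod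
      (integrable_withDens hφ.memLp (memLp_normHermite _))).const_mul _

end convolution

/-- The `χ₂`-bound for the law of `aU + bV`, under Hypothesis (H). -/
lemma chi2Dist_convLaw_le {r N : ℕ} {f : ℝ → ℝ} {φ : Polynomial ℝ}
    (hf : IsL2Density f) (hfm : MomentsMatch f r)
    (hφ : IsL2Density (fun x => φ.eval x)) (hφm : MomentsMatch (fun x => φ.eval x) r)
    (hN : φ.natDegree ≤ N) (hr : 1 ≤ r)
    (H : HypothesisH (r + 1) N (hermiteCoeff (fun y => φ.eval y)))
    {a : ℝ} (ha : aThreshold r N < a) (ha1 : a < 1) :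
    chi2Dist (convLaw a (Real.sqrt (1 - a ^ 2)) f (fun x => φ.eval x)) stdNormal ≤
      ENNReal.ofReal (a ^ (r + 1) * (1 + dFun r N (hermiteCoeff (fun y => φ.eval y)) a)) * chi2 f
        + ENNReal.ofReal ((1 - a ^ 2) ^ (((r : ℝ) + 1) / 2)) * chi2 (fun x => φ.eval x) := by
  have ha0 : 0 < a := lt_trans (by unfold aThreshold; positivity) ha
  have hb2 : 0 ≤ 1 - a ^ 2 := by nlinarith
  rw [Real.rpow_div_two_eq_sqrt _ hb2, show (r : ℝ) + 1 = ((r + 1 : ℕ) : ℝ) by push_cast; rfl,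
    Real.rpow_natCast]
  set c := hermiteCoeff (fun y => φ.eval y) with hcdef
  set b := √(1 - a ^ 2) with hbdef
  have hb0 : 0 ≤ b := Real.sqrt_nonneg _
  have hb1 : b ≤ 1 := Real.sqrt_le_one.2 (by nlinarith)
  have hab : a ^ 2 + b ^ 2 = 1 := by rw [hbdef, Real.sq_sqrt hb2]; ring
  have hc0 : c 0 = 1 := hermiteCoeff_zero hφ
  have hc (k : ℕ) (hk : 1 ≤ k) (h : k < r + 1 ∨ N < k) : c k = 0 := by
    rcases h with h | h
    · exact hermiteCoeff_eq_zero hφ hφm hk (by omega)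
    · exact hermiteCoeff_polynomial_eq_zero (by omega)
  set M := a ^ (r + 1) * (1 + dFun r N c a)
  have hM : 0 ≤ M := by
    refine mul_nonneg (by positivity) (add_nonneg zero_le_one ?_)
    refine le_trans (Finset.sum_nonneg fun k _ => ?_) (sum_gammaCoeff_le_dFun ha0 ha1)
    exact mul_nonneg (gammaCoeff_nonneg _ _ _ _) (by positivity)
  -- `h` holds the coefficients of `f - 1`, `u` the contribution of `k ≥ r + 1`, and `v` that of `k
  -- = 0` without the constant term.
  let h : ℕ → ℝ := fun k => if k = 0 then 0 else hermiteCoeff f k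
  let u : ℕ → ℝ := fun n => ∑ p ∈ Finset.HasAntidiagonal.antidiagonal n,
    entry (r + 1) a b c p.1 p.2 * h p.1
  let v : ℕ → ℝ := fun n => if n = 0 then 0 else b ^ n * c n
  have hsq {g : ℝ → ℝ} (hg : MemLp g 2 stdNormal) (m : ℕ) :
      ∑ k ∈ Finset.range m, (if k = 0 then 0 else hermiteCoeff g k) ^ 2
        ≤ ‖hg.toLp g - hermiteL2 0‖ ^ 2 := by
    refine le_trans (le_of_eq ?_) (sum_sq_hermiteCoeff_le hg (Finset.notMem_erase 0 (Finset.range m)))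
    rw [← Finset.sum_erase (a := 0) _ (by simp)]
    exact Finset.sum_congr rfl fun k hk => by rw [if_neg (Finset.ne_of_mem_erase hk)]
  obtain ⟨U, hU, hUn⟩ := exists_inner_hermiteL2_eq (w := u)
    (C := M * ‖hf.memLp.toLp f - hermiteL2 0‖) (by positivity) fun m => by
      rw [mul_pow]
      exact (sum_sq_entry_le hr H ha ha1 hc0 hc h m).trans
        (mul_le_mul_of_nonneg_left (hsq hf.memLp m) (sq_nonneg _))
  obtain ⟨V, hV, hVn⟩ := exists_inner_hermiteL2_eq (w := v)
    (C := b ^ (r + 1) * ‖hφ.memLp.toLp _ - hermiteL2 0‖) (by positivity) fun m => by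
      rw [mul_pow]
      refine le_trans ?_ (mul_le_mul_of_nonneg_left (hsq hφ.memLp m) (sq_nonneg _))
      rw [Finset.mul_sum]
      refine Finset.sum_le_sum fun n _ => ?_
      rw [← mul_pow, ← hcdef]
      simp only [v]
      split_ifs with hn
      · simp
      · by_cases hn' : n < r + 1
        · rw [hc n (by omega) (Or.inl hn')]; simp
        · rw [mul_pow, mul_pow]
          refine mul_le_mul_of_nonneg_right ?_ (sq_nonneg _)
          exact pow_le_pow_left₀ (by positivity)
            (pow_le_pow_of_le_one hb0 hb1 (by omega)) 2
  have hθ := integrable_exp_convLaw (a := a) (b := b) hf.memLp hφ.memLp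
  have hmom (n : ℕ) : ∫ x, normHermite n x ∂convLaw a b f (fun x => φ.eval x)
      = inner ℝ (hermiteL2 n) (hermiteL2 0 + U + V) := by
    rw [integral_normHermite_convLaw hab hf hφ, inner_add_right, inner_add_right, hU, hV,
      orthonormal_iff_ite.1 orthonormal_hermiteL2 n 0]
    -- Three ranges of `k`: 0, then `1 ≤ k ≤ r` where `f_k` vanishes, then the matrix part.
    have hterm (p : ℕ × ℕ) : √((p.1 + p.2).choose p.1 : ℝ) * a ^ p.1 * b ^ p.2
        * (hermiteCoeff f p.1 * c p.2)
        = entry (r + 1) a b c p.1 p.2 * h p.1 + if p.1 = 0 then b ^ p.2 * c p.2 else 0 := by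
      by_cases h0 : p.1 = 0
      · simp [h0, h, hermiteCoeff_zero hf]
      · by_cases h1 : r + 1 ≤ p.1
        · simp [h0, h, entry, h1]; ring
        · simp [h0, entry, h1, hermiteCoeff_eq_zero hf hfm (k := p.1) (by omega) (by omega)]
    rw [Finset.sum_congr rfl fun p _ => hterm p, Finset.sum_add_distrib,
      Finset.sum_eq_single (0, n) (f := fun p : ℕ × ℕ => if p.1 = 0 then b ^ p.2 * c p.2 else 0)]
    · simp only [u, v]
      rcases Nat.eq_zero_or_pos n with rfl | hn
      · simp [hc0]; ring
      · simp [hn.ne']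
    · intro p hp hp'
      rw [Finset.HasAntidiagonal.mem_antidiagonal] at hp
      refine if_neg fun h0 => hp' ?_
      rw [h0, zero_add] at hp
      exact Prod.ext h0 hp
    · intro hp
      exact absurd (by simp) hp
  have : IsFiniteMeasure (convLaw a b f (fun x => φ.eval x)) := by
    have := isFiniteMeasure_withDens hf.memLp
    have := isFiniteMeasure_withDens hφ.memLp
    unfold convLaw; infer_instance
  obtain ⟨hG, hG0⟩ := eq_withDens_of_hermite_moments hθ _ hmom
  rw [hG, chi2Dist_withDens (Lp.memLp _) hG0, eLpNorm_sub_one, hf.chi2_eq, hφ.chi2_eq,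
    ← ENNReal.ofReal_mul hM, ← ENNReal.ofReal_mul (by positivity),
    ← ENNReal.ofReal_add (by positivity) (by positivity)]
  refine ENNReal.ofReal_le_ofReal ?_
  rw [add_assoc, add_sub_cancel_left]
  exact (norm_add_le U V).trans (add_le_add hUn hVn)

theorem theorem2 (r N : ℕ) (f : ℝ → ℝ) (φ : Polynomial ℝ)
    (hf : IsL2Density f) (hfm : MomentsMatch f r)
    (hφ : IsL2Density (fun x => φ.eval x)) (hφm : MomentsMatch (fun x => φ.eval x) r)
    (hN : φ.natDegree ≤ N) :
    (∀ x : ℝ, φ.eval x =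
      1 + ∑ k ∈ Finset.Icc (r + 1) N,
        hermiteCoeff (fun y => φ.eval y) k * normHermite k x) ∧
    (1 ≤ r → HypothesisH (r + 1) N (hermiteCoeff (fun y => φ.eval y)) →
      ∀ a : ℝ, aThreshold r N < a → a < 1 →
        chi2Dist (convLaw a (Real.sqrt (1 - a ^ 2)) f (fun x => φ.eval x)) stdNormal ≤
          ENNReal.ofReal (a ^ (r + 1) * (1 + dFun r N (hermiteCoeff (fun y => φ.eval y)) a))
              * chi2 f
            + ENNReal.ofReal ((1 - a ^ 2) ^ (((r : ℝ) + 1) / 2)) * chi2 (fun x => φ.eval x)) ∧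
    (∃ L : ℝ, Tendsto
      (fun a : ℝ => |Real.log a| ^ (-(((r : ℝ) + 1) / 2))
        * dFun r N (hermiteCoeff (fun y => φ.eval y)) a)
      (𝓝[<] (1 : ℝ)) (𝓝 L)) := by
  exact ⟨eval_eq_one_add_sum_hermiteCoeff hφ hφm hN,
    fun hr H _ ha ha1 => chi2Dist_convLaw_le hf hfm hφ hφm hN hr H ha ha1,
    tendsto_dFun r N _⟩
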